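/- Let $\varphi(t) = 2^{1/4}\mathrm{e}^{-\pi t^2}$ be the normalized Gaussian and, for $f\in L^2(\mathbb{R})$, let $$\mathcal{G}f(x,\omega) = 2^{1/4}\int_{\mathbb{R}} f(t)\,\mathrm{e}^{-\pi(t-x)^2}\,\mathrm{e}^{-2\pi \mathrm{i} t\omega}\,\mathrm{d}t, \qquad (x,\omega)\in\mathbb{R}^2,$$ be its Gabor transform. Then $|\mathcal{G}\varphi(x,\omega)|^2 = \mathrm{e}^{-\pi(x^2+\omega^2)}$ for all $(x,\omega)\in\mathbb{R}^2$. Moreover, let $0<a<1$ and let $f\in L^2(\mathbb{R})$ (complex-valued) satisfy $$|\mathcal{G}f(x,\omega)|^2 = \mathrm{e}^{-\pi(x^2+\omega^2)} = |\mathcal{G}\varphi(x,\omega)|^2 \qquad \text{for all } (x,\omega)\in a\mathbb{Z}^2 .$$ Then there exists $\alpha\in\mathbb{R}$ such that $f = \mathrm{e}^{\mathrm{i}\alpha}\varphi$ in $L^2(\mathbb{R})$, that is, almost everywhere. -/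

import Mathlib

open MeasureTheory

noncomputable section

/-- The normalized Gaussian `φ(t) = 2^{1/4} e^{-π t²}`, as a complex-valued function on `ℝ`. -/
def normalizedGaussian (t : ℝ) : ℂ :=
  (((2 : ℝ) ^ (1 / 4 : ℝ) * Real.exp (-Real.pi * t ^ 2) : ℝ) : ℂ)

/-- The Gabor transform
`G f (x, ω) = 2^{1/4} ∫ f(t) e^{-π (t - x)²} e^{-2 π i t ω} dt`.
For `f ∈ L²(ℝ)` the integrand is integrable at every `(x, ω)`. -/
def gaborTransform (f : ℝ → ℂ) (x ω : ℝ) : ℂ :=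
  (((2 : ℝ) ^ (1 / 4 : ℝ) : ℝ) : ℂ) *
    ∫ t : ℝ, f t * ((Real.exp (-Real.pi * (t - x) ^ 2) : ℝ) : ℂ) *
      Complex.exp (-2 * (Real.pi : ℂ) * Complex.I * (t : ℂ) * (ω : ℂ))

end

/-! Up to a Gaussian factor and a reflection in frequency, the Gabor transform is an entire
function: `fockTransform f` has modulus `|𝒢f| e^{π|z|²/2}`, and the Gaussian corresponds to the
constant 1. Since `𝒢f` is bounded, `F(z) = fockTransform f (a z)` grows at most like `e^{π
a²|z|²/2}`, strictly below the type `π/2` because `a < 1`, while the samples say `|F| = 1` on the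
Gaussian integers.

The core is a Liouville theorem, `eq_of_bounded_on_latticePt`: such an `F` is constant. Let `σ` be
the sigma function of `ℤ[i]`, of exact type `π/2`, with simple zeros at the lattice points. On large
squares avoiding the lattice, `F/σ` tends to 0. At a lattice point `λ`, `|σ'(λ)|` is `e^{π|λ|²/2}`
times a constant, so bounded data give uniformly bounded partial fractions. The maximum principle
then bounds `F` on the unit cell by its lattice values alone
(`exists_norm_le_mul_of_lattice_bound`). Translation spreads the bound to the whole plane.

Hence `fockTransform f` is a unimodular constant, and injectivity of the Bargmann transform
(`ae_eq_of_bargmann_eq`) identifies `f`. -/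

/-! ### The `q`-Pochhammer product -/

/-- The infinite product `∏ (1 - qⁿ w)`, the `q`-Pochhammer symbol `(w; q)_∞`. -/
noncomputable def qProd (q w : ℂ) : ℂ := ∏' n : ℕ, (1 + -(q ^ n * w))

lemma summable_norm_qProd_term {q : ℂ} (hq : ‖q‖ < 1) (w : ℂ) :
    Summable fun n : ℕ => ‖-(q ^ n * w)‖ := by
  simpa using (summable_geometric_of_lt_one (norm_nonneg _) hq).mul_right ‖w‖

lemma qProd_eq {q : ℂ} (hq : ‖q‖ < 1) (w : ℂ) : qProd q w = (1 - w) * qProd q (q * w) := by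
  have h := multipliable_one_add_of_summable (summable_norm_qProd_term hq (q * w))
  unfold qProd
  rw [tprod_eq_zero_mul']
  · simp [sub_eq_add_neg, pow_succ, mul_assoc]
  · simpa [pow_succ, mul_assoc] using h

lemma qProd_ne_zero {q : ℂ} (hq : ‖q‖ < 1) {w : ℂ} (h : ∀ n : ℕ, q ^ n * w ≠ 1) :
    qProd q w ≠ 0 := by
  refine tprod_one_add_ne_zero_of_summable (fun n => ?_) (summable_norm_qProd_term hq w)
  intro h0
  exact h n (by linear_combination -h0)

lemma differentiable_qProd {q : ℂ} (hq : ‖q‖ < 1) : Differentiable ℂ (qProd q) := by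
  intro w
  have hU : IsOpen (Metric.ball (0 : ℂ) (‖w‖ + 1)) := Metric.isOpen_ball
  have hP := Summable.hasProdLocallyUniformlyOn_nat_one_add
    (f := fun (n : ℕ) (w : ℂ) => -(q ^ n * w)) hU
    (u := fun n : ℕ => ‖q‖ ^ n * (‖w‖ + 1))
    ((summable_geometric_of_lt_one (norm_nonneg _) hq).mul_right _)
    (.of_forall fun n x hx => by
      rw [norm_neg, norm_mul, norm_pow]
      exact mul_le_mul_of_nonneg_left (by simpa using (mem_ball_zero_iff.1 hx).le) (by positivity))
    (fun n => by fun_prop)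
  have := hP.differentiableOn (.of_forall fun _ => by
    simpa [Finset.prod_fn] using DifferentiableOn.finsetProd (fun _ _ => by fun_prop)) hU
  exact (this w (by simp)).differentiableAt (hU.mem_nhds (by simp))

/-! ### The sigma function of the Gaussian integers -/

/-- The nome of the square lattice. -/
noncomputable def squareNome : ℂ := Complex.exp (-2 * Real.pi)

lemma norm_squareNome : ‖squareNome‖ < 1 := by
  simp [squareNome, Complex.norm_exp, Real.pi_pos]

/-- A Weierstrass sigma function of the lattice `ℤ + ℤi`, given by its product expansion. -/
noncomputable def gaussSigma (z : ℂ) : ℂ :=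
  Complex.exp (Real.pi * z ^ 2 / 2 - Real.pi * Complex.I * z) *
    (qProd squareNome (Complex.exp (2 * Real.pi * Complex.I * z)) *
      qProd squareNome (squareNome * Complex.exp (-(2 * Real.pi * Complex.I * z))))

lemma differentiable_gaussSigma : Differentiable ℂ gaussSigma := by
  have h := differentiable_qProd norm_squareNome
  unfold gaussSigma
  fun_prop

lemma gaussSigma_add_one (z : ℂ) :
    gaussSigma (z + 1) = -Complex.exp (Real.pi * z + Real.pi / 2) * gaussSigma z := by
  have h1 : Complex.exp (2 * Real.pi * Complex.I * (z + 1)) =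
      Complex.exp (2 * Real.pi * Complex.I * z) := by
    rw [mul_add, Complex.exp_add, mul_one, Complex.exp_two_pi_mul_I, mul_one]
  have h2 : Complex.exp (Real.pi * (z + 1) ^ 2 / 2 - Real.pi * Complex.I * (z + 1)) =
      -Complex.exp (Real.pi * z + Real.pi / 2) *
        Complex.exp (Real.pi * z ^ 2 / 2 - Real.pi * Complex.I * z) := by
    rw [neg_mul, ← Complex.exp_add, ← mul_neg_one, ← Complex.exp_neg_pi_mul_I, ← Complex.exp_add]
    congr 1
    ring
  unfold gaussSigma
  rw [Complex.exp_neg, Complex.exp_neg, h1, h2, mul_assoc]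

lemma gaussSigma_add_I (z : ℂ) :
    gaussSigma (z + Complex.I) =
      -Complex.exp (-Real.pi * Complex.I * z + Real.pi / 2) * gaussSigma z := by
  set w := Complex.exp (2 * Real.pi * Complex.I * z) with hw
  have hw0 : w ≠ 0 := Complex.exp_ne_zero _
  have hq0 : squareNome ≠ 0 := Complex.exp_ne_zero _
  have h1 : Complex.exp (2 * Real.pi * Complex.I * (z + Complex.I)) = squareNome * w := by
    rw [hw, squareNome, ← Complex.exp_add]
    congr 1
    linear_combination (2 * Real.pi : ℂ) * Complex.I_sq
  have h2 : Complex.exp (Real.pi * (z + Complex.I) ^ 2 / 2 -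
        Real.pi * Complex.I * (z + Complex.I)) =
      Complex.exp (-Real.pi * Complex.I * z + Real.pi / 2) * w *
        Complex.exp (Real.pi * z ^ 2 / 2 - Real.pi * Complex.I * z) := by
    rw [hw, ← Complex.exp_add, ← Complex.exp_add]
    congr 1
    linear_combination (-Real.pi / 2 : ℂ) * Complex.I_sq
  -- The shift sends `w` to `qw`: the first product loses the factor `1 - w`, the second gains `1 -
  -- w⁻¹`. Their quotient is `-w⁻¹`, which cancels the `w` in `h2`.
  have h3 := qProd_eq norm_squareNome w
  have h4 := qProd_eq norm_squareNome w⁻¹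
  unfold gaussSigma
  rw [Complex.exp_neg, Complex.exp_neg, h1, h2, ← hw, mul_inv, mul_inv_cancel_left₀ hq0, h3, h4]
  field_simp
  ring

/-- The periods `l` for which `gaussSigma` has the quasi-periodicity of a sigma function. -/
def IsSigmaPeriod (l : ℂ) : Prop :=
  ∃ e : ℂ, ‖e‖ = 1 ∧ ∀ z, gaussSigma (z + l) =
    e * Complex.exp (Real.pi * (starRingEnd ℂ l * z) + Real.pi / 2 * (starRingEnd ℂ l * l)) *
      gaussSigma z

/-- Composing the two shifts leaves an extra factor whose exponent is half `π` times a number minus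
its conjugate, hence unimodular. As periods form a group, only 1 and `i` need a computation. -/
lemma IsSigmaPeriod.add {l m : ℂ} (hl : IsSigmaPeriod l) (hm : IsSigmaPeriod m) :
    IsSigmaPeriod (l + m) := by
  obtain ⟨e, he, hl⟩ := hl
  obtain ⟨e', he', hm⟩ := hm
  refine ⟨e * e' * Complex.exp (Real.pi / 2 *
    (starRingEnd ℂ m * l - starRingEnd ℂ l * m)), ?_, fun z => ?_⟩
  · rw [norm_mul, norm_mul, he, he', Complex.norm_exp, one_mul, one_mul, Real.exp_eq_one_iff]
    simp [Complex.mul_re]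
    ring
  · rw [← add_assoc, hm, hl]
    simp only [← mul_assoc]
    rw [show ∀ a b s : ℂ, e' * a * e * b * s = e * e' * (a * b) * s by intros; ring]
    rw [← Complex.exp_add, mul_assoc (e * e') (Complex.exp _) (Complex.exp _), ← Complex.exp_add]
    congr 3
    simp only [map_add]
    ring

lemma IsSigmaPeriod.neg {l : ℂ} (hl : IsSigmaPeriod l) : IsSigmaPeriod (-l) := by
  obtain ⟨e, he, hl⟩ := hl
  refine ⟨e⁻¹, by simp [he], fun z => ?_⟩
  have h := hl (z + -l)
  rw [neg_add_cancel_right] at h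
  have he0 : e ≠ 0 := by
    rintro rfl
    simp at he
  rw [h]
  rw [show ∀ a b s : ℂ, e⁻¹ * a * (e * b * s) = (e⁻¹ * e) * (a * b) * s by intros; ring,
    inv_mul_cancel₀ he0, one_mul, ← Complex.exp_add]
  simp only [map_neg]
  ring_nf
  simp

lemma isSigmaPeriod_zero : IsSigmaPeriod 0 := ⟨1, by simp, fun z => by simp⟩

lemma isSigmaPeriod_one : IsSigmaPeriod 1 :=
  ⟨-1, by simp, fun z => by rw [gaussSigma_add_one]; simp⟩

lemma isSigmaPeriod_I : IsSigmaPeriod Complex.I :=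
  ⟨-1, by simp, fun z => by
    rw [gaussSigma_add_I]
    simp only [Complex.conj_I, neg_mul, Complex.I_mul_I, one_mul, neg_neg, mul_one, mul_neg,
      mul_assoc]⟩

/-- The subgroup of periods of `gaussSigma`. -/
def sigmaPeriods : AddSubgroup ℂ where
  carrier := {l | IsSigmaPeriod l}
  add_mem' := IsSigmaPeriod.add
  zero_mem' := isSigmaPeriod_zero
  neg_mem' := IsSigmaPeriod.neg

/-- The point `m + ni` of the square lattice. -/
def latticePt (p : ℤ × ℤ) : ℂ := p.1 + p.2 * Complex.I

lemma isSigmaPeriod_latticePt (p : ℤ × ℤ) : IsSigmaPeriod (latticePt p) := by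
  have h1 : (1 : ℂ) ∈ sigmaPeriods := isSigmaPeriod_one
  have h2 : Complex.I ∈ sigmaPeriods := isSigmaPeriod_I
  have := sigmaPeriods.add_mem (sigmaPeriods.zsmul_mem h1 p.1) (sigmaPeriods.zsmul_mem h2 p.2)
  simp only [zsmul_eq_mul, mul_one] at this
  exact this

lemma IsSigmaPeriod.weight_add {l : ℂ} (hl : IsSigmaPeriod l) (z : ℂ) :
    ‖gaussSigma (z + l)‖ * Real.exp (-(Real.pi / 2) * ‖z + l‖ ^ 2) =
      ‖gaussSigma z‖ * Real.exp (-(Real.pi / 2) * ‖z‖ ^ 2) := by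
  obtain ⟨e, he, hl⟩ := hl
  rw [hl, norm_mul, norm_mul, he, Complex.norm_exp, one_mul, mul_right_comm, ← Real.exp_add,
    mul_comm]
  congr 2
  simp only [← Complex.normSq_eq_norm_sq, Complex.normSq_apply]
  simp [Complex.mul_re]
  ring

/-- A factor vanishes only when `e^{2πiz}` is an integral power of the nome. Conversely the factor
`n = 0` vanishes at the origin, and quasi-periodicity carries this zero to every lattice point. -/
lemma gaussSigma_eq_zero_iff (z : ℂ) : gaussSigma z = 0 ↔ ∃ p, z = latticePt p := by
  constructor
  · intro h
    by_contra! hne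
    have key (k : ℤ) : Complex.exp (-2 * Real.pi * k) * Complex.exp (2 * Real.pi * Complex.I * z)
        ≠ 1 := by
      rw [← Complex.exp_add, Ne, Complex.exp_eq_one_iff]
      rintro ⟨n, hn⟩
      refine hne (n, -k) ?_
      have : (2 * Real.pi * Complex.I : ℂ) ≠ 0 := Complex.two_pi_I_ne_zero
      apply mul_left_cancel₀ this
      simp only [latticePt]
      push_cast
      linear_combination hn + 2 * Real.pi * k * Complex.I_sq
    have hpow (n : ℕ) : squareNome ^ n = Complex.exp (-2 * Real.pi * n) := by
      rw [squareNome, ← Complex.exp_nat_mul, mul_comm]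
    refine mul_ne_zero (Complex.exp_ne_zero _) (mul_ne_zero ?_ ?_) h
    · exact qProd_ne_zero norm_squareNome fun n => by
        rw [hpow]
        simpa using key n
    · refine qProd_ne_zero norm_squareNome fun n h1 => ?_
      rw [← mul_assoc, ← pow_succ, hpow, Complex.exp_neg, mul_inv_eq_one₀ (Complex.exp_ne_zero _)]
        at h1
      apply key (-(n + 1))
      rw [← h1, ← Complex.exp_add, Complex.exp_eq_one_iff]
      exact ⟨0, by push_cast; ring⟩
  · rintro ⟨p, rfl⟩
    obtain ⟨e, -, he⟩ := isSigmaPeriod_latticePt p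
    have h0 : gaussSigma 0 = 0 := by
      simp [gaussSigma, qProd_eq norm_squareNome 1]
    have := he 0
    rwa [h0, mul_zero, zero_add] at this

lemma gaussSigma_zero : gaussSigma 0 = 0 :=
  (gaussSigma_eq_zero_iff 0).2 ⟨0, by simp [latticePt]⟩

lemma deriv_gaussSigma_zero_ne : deriv gaussSigma 0 ≠ 0 := by
  set g : ℂ → ℂ := fun z => Complex.exp (Real.pi * z ^ 2 / 2 - Real.pi * Complex.I * z) *
    (qProd squareNome (squareNome * Complex.exp (2 * Real.pi * Complex.I * z)) *
      qProd squareNome (squareNome * Complex.exp (-(2 * Real.pi * Complex.I * z)))) with hg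
  have hfac : gaussSigma = fun z => (1 - Complex.exp (2 * Real.pi * Complex.I * z)) * g z := by
    ext z
    rw [gaussSigma, qProd_eq norm_squareNome (Complex.exp (2 * Real.pi * Complex.I * z)), hg]
    ring
  have hgd : Differentiable ℂ g := by
    have h := differentiable_qProd norm_squareNome
    rw [hg]
    fun_prop
  have hq1 : qProd squareNome squareNome ≠ 0 := by
    refine qProd_ne_zero norm_squareNome fun n h => ?_
    have h2 : ‖squareNome‖ ^ (n + 1) = 1 := by
      rw [← norm_pow, pow_succ, h, norm_one]
    exact (pow_lt_one₀ (norm_nonneg _) norm_squareNome n.succ_ne_zero).ne h2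
  have h1 : HasDerivAt (fun z : ℂ => 1 - Complex.exp (2 * Real.pi * Complex.I * z))
      (-(2 * Real.pi * Complex.I)) 0 := by
    have := (((hasDerivAt_id (0 : ℂ)).const_mul (2 * Real.pi * Complex.I)).cexp).const_sub 1
    simpa using this
  have h2 := h1.mul (hgd 0).hasDerivAt
  have h3 : deriv gaussSigma 0 = -(2 * Real.pi * Complex.I) * g 0 := by
    rw [hfac]
    refine h2.deriv.trans ?_
    simp
  rw [h3]
  refine mul_ne_zero (neg_ne_zero.2 Complex.two_pi_I_ne_zero) ?_
  simp [hg, hq1]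

/-- Differentiate the quasi-periodicity relation at 0; the term containing `σ(0)` drops out. -/
lemma norm_deriv_gaussSigma_latticePt (p : ℤ × ℤ) :
    ‖deriv gaussSigma (latticePt p)‖ =
      Real.exp (Real.pi / 2 * ‖latticePt p‖ ^ 2) * ‖deriv gaussSigma 0‖ := by
  obtain ⟨e, he, hp⟩ := isSigmaPeriod_latticePt p
  set l := latticePt p
  have h1 : deriv (fun z => gaussSigma (z + l)) 0 = deriv gaussSigma l := by
    rw [deriv_comp_add_const, zero_add]
  have hE : Differentiable ℂ fun z => e * Complex.exp (Real.pi * (starRingEnd ℂ l * z) +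
      Real.pi / 2 * (starRingEnd ℂ l * l)) := by fun_prop
  have h2 := ((hE 0).hasDerivAt.mul (differentiable_gaussSigma 0).hasDerivAt).deriv
  rw [← h1, funext hp]
  refine (congrArg norm h2).trans ?_
  rw [gaussSigma_zero, mul_zero, zero_add, norm_mul, norm_mul, he, one_mul, Complex.norm_exp]
  congr 2
  rw [← Complex.normSq_eq_norm_sq, Complex.normSq_apply]
  simp [Complex.mul_re]

/-! ### Division by a function with simple zeros -/

/-- A holomorphic function that vanishes at the zeros of `s`, all of which are simple, is divisible
by `s`. -/
lemma exists_differentiableOn_eq_mul {U : Set ℂ} (hU : IsOpen U) {g s : ℂ → ℂ}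
    (hg : DifferentiableOn ℂ g U) (hs : DifferentiableOn ℂ s U)
    (hzero : ∀ z ∈ U, s z = 0 → g z = 0 ∧ deriv s z ≠ 0) :
    ∃ h : ℂ → ℂ, DifferentiableOn ℂ h U ∧ ∀ z ∈ U, g z = s z * h z := by
  classical
  refine ⟨fun z => if s z = 0 then deriv g z / deriv s z else g z / s z, fun z hz => ?_,
    fun z hz => ?_⟩
  · by_cases h0 : s z = 0
    · obtain ⟨hgz, hsz⟩ := hzero z hz h0
      have hUz := hU.mem_nhds hz
      -- Near a common zero the quotient equals the quotient of the difference slopes, which is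
      -- holomorphic because the zero of `s` is simple.
      have hdg := ((Complex.differentiableOn_dslope hUz).2 hg).differentiableAt hUz
      have hds := ((Complex.differentiableOn_dslope hUz).2 hs).differentiableAt hUz
      have hne : dslope s z z ≠ 0 := by rwa [dslope_same]
      refine ((hdg.div hds hne).congr_of_eventuallyEq ?_).differentiableWithinAt
      filter_upwards [hds.continuousAt.eventually_ne hne] with w hw
      by_cases hwz : w = z
      · subst hwz
        simp [h0, dslope_same]
      · have hsub : w - z ≠ 0 := sub_ne_zero.2 hwz
        rw [dslope_of_ne _ hwz, slope_def_field, h0, sub_zero] at hw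
        have hsw : s w ≠ 0 := fun h => hw (by simp [h])
        simp only [Pi.div_apply]
        rw [if_neg hsw, dslope_of_ne _ hwz, dslope_of_ne _ hwz, slope_def_field, slope_def_field,
          h0, hgz, sub_zero, sub_zero]
        field_simp
    · have hgd := hg.differentiableAt (hU.mem_nhds hz)
      have hsd := hs.differentiableAt (hU.mem_nhds hz)
      refine ((hgd.div hsd h0).congr_of_eventuallyEq ?_).differentiableWithinAt
      filter_upwards [hsd.continuousAt.eventually_ne h0] with w hw
      simp [hw]
  · by_cases h0 : s z = 0
    · simp [h0, (hzero z hz h0).1]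
    · simp only [h0, if_false]
      field_simp

/-! ### Squares avoiding the lattice, and the size of sigma -/

/-- The open square of half-side `r` centred at the origin. -/
def openSquare (r : ℝ) : Set ℂ := Set.Ioo (-r) r ×ℂ Set.Ioo (-r) r

lemma isOpen_openSquare (r : ℝ) : IsOpen (openSquare r) := isOpen_Ioo.reProdIm isOpen_Ioo

lemma isBounded_openSquare (r : ℝ) : Bornology.IsBounded (openSquare r) :=
  (Metric.isBounded_Ioo _ _).reProdIm (Metric.isBounded_Ioo _ _)

lemma closure_openSquare {r : ℝ} (hr : 0 < r) :
    closure (openSquare r) = Set.Icc (-r) r ×ℂ Set.Icc (-r) r := by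
  rw [openSquare, Complex.closure_reProdIm, closure_Ioo (by linarith)]

lemma mem_closure_openSquare {r : ℝ} (hr : 0 < r) {z : ℂ} :
    z ∈ closure (openSquare r) ↔ |z.re| ≤ r ∧ |z.im| ≤ r := by
  rw [closure_openSquare hr, Complex.mem_reProdIm, Set.mem_Icc, Set.mem_Icc, abs_le, abs_le]

lemma isCompact_closure_openSquare (r : ℝ) : IsCompact (closure (openSquare r)) :=
  (isBounded_openSquare r).isCompact_closure

lemma mem_openSquare {r : ℝ} {z : ℂ} : z ∈ openSquare r ↔ |z.re| < r ∧ |z.im| < r := by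
  rw [openSquare, Complex.mem_reProdIm, Set.mem_Ioo, Set.mem_Ioo, abs_lt, abs_lt]

lemma half_le_abs_sub_int (N : ℕ) {x : ℝ} (hx : |x| = N + 1 / 2) (m : ℤ) : 1 / 2 ≤ |x - m| := by
  rcases abs_eq (by positivity : (0 : ℝ) ≤ N + 1 / 2) |>.1 hx with rfl | rfl
  · rcases le_or_gt m N with h | h
    · have : (m : ℝ) ≤ N := by exact_mod_cast h
      exact le_abs.2 (Or.inl (by linarith))
    · have : (N : ℝ) + 1 ≤ m := by exact_mod_cast h
      exact le_abs.2 (Or.inr (by linarith))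
  · rcases lt_or_ge m (-N) with h | h
    · have : (m : ℝ) + 1 ≤ -N := by exact_mod_cast h
      exact le_abs.2 (Or.inl (by linarith))
    · have : -(N : ℝ) ≤ m := by exact_mod_cast h
      exact le_abs.2 (Or.inr (by linarith))

/-- The points at distance at least `1/2` from the lattice. -/
def farFromLattice : Set ℂ := {z | ∀ p, 1 / 2 ≤ ‖z - latticePt p‖}

lemma latticePt_re (p : ℤ × ℤ) : (latticePt p).re = p.1 := by simp [latticePt]

lemma latticePt_im (p : ℤ × ℤ) : (latticePt p).im = p.2 := by simp [latticePt]

lemma mem_frontier_openSquare (N : ℕ) {z : ℂ} (hz : z ∈ frontier (openSquare (N + 1 / 2))) :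
    (|z.re| = N + 1 / 2 ∨ |z.im| = N + 1 / 2) ∧ |z.re| ≤ N + 1 / 2 ∧ |z.im| ≤ N + 1 / 2 := by
  rw [(isOpen_openSquare _).frontier_eq, Set.mem_sdiff, mem_closure_openSquare (by positivity),
    mem_openSquare] at hz
  obtain ⟨h, h'⟩ := hz
  refine ⟨?_, h⟩
  by_contra! hne
  exact h' ⟨lt_of_le_of_ne h.1 hne.1, lt_of_le_of_ne h.2 hne.2⟩

lemma frontier_subset_far (N : ℕ) : frontier (openSquare (N + 1 / 2)) ⊆ farFromLattice := by
  intro z hz p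
  rcases (mem_frontier_openSquare N hz).1 with h | h
  · calc (1 / 2 : ℝ) ≤ |z.re - p.1| := half_le_abs_sub_int N h _
      _ = |(z - latticePt p).re| := by rw [Complex.sub_re, latticePt_re]
      _ ≤ _ := Complex.abs_re_le_norm _
  · calc (1 / 2 : ℝ) ≤ |z.im - p.2| := half_le_abs_sub_int N h _
      _ = |(z - latticePt p).im| := by rw [Complex.sub_im, latticePt_im]
      _ ≤ _ := Complex.abs_im_le_norm _

lemma le_norm_of_mem_frontier (N : ℕ) {z : ℂ} (hz : z ∈ frontier (openSquare (N + 1 / 2))) :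
    (N : ℝ) + 1 / 2 ≤ ‖z‖ := by
  rcases (mem_frontier_openSquare N hz).1 with h | h
  · exact h ▸ Complex.abs_re_le_norm z
  · exact h ▸ Complex.abs_im_le_norm z

/-- The lattice point obtained by rounding both coordinates. -/
noncomputable def roundPt (z : ℂ) : ℤ × ℤ := (round z.re, round z.im)

lemma sub_roundPt_mem (z : ℂ) : z - latticePt (roundPt z) ∈ closure (openSquare (1 / 2)) := by
  rw [mem_closure_openSquare (by norm_num), Complex.sub_re, Complex.sub_im, latticePt_re,
    latticePt_im]
  exact ⟨abs_sub_round _, abs_sub_round _⟩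

/-- Lower bound for the sigma function away from its zeros. -/
lemma exists_le_norm_gaussSigma : ∃ δ > 0, ∀ z ∈ farFromLattice,
    δ * Real.exp (Real.pi / 2 * ‖z‖ ^ 2) ≤ ‖gaussSigma z‖ := by
  set W : ℂ → ℝ := fun z => ‖gaussSigma z‖ * Real.exp (-(Real.pi / 2) * ‖z‖ ^ 2)
  have hW : Continuous W := by
    have := differentiable_gaussSigma.continuous
    fun_prop
  -- The unit cell without the disc of radius 1/2 is compact and contains no zero of `σ`.
  set K := closure (openSquare (1 / 2)) ∩ {z | 1 / 2 ≤ ‖z‖}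
  have hK : IsCompact K := (isCompact_closure_openSquare _).inter_right
    (isClosed_le continuous_const continuous_norm)
  have hKne : K.Nonempty := ⟨1 / 2, by
    rw [mem_closure_openSquare (by norm_num)]
    norm_num, by norm_num⟩
  obtain ⟨w, hwK, hw⟩ := hK.exists_isMinOn hKne hW.continuousOn
  have hwpos : 0 < W w := by
    refine mul_pos (norm_pos_iff.2 fun h0 => ?_) (Real.exp_pos _)
    obtain ⟨p, rfl⟩ := (gaussSigma_eq_zero_iff w).1 h0
    obtain ⟨h1, h2⟩ := hwK
    rw [mem_closure_openSquare (by norm_num), latticePt_re, latticePt_im] at h1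
    have key (n : ℤ) (hn : |(n : ℝ)| ≤ 1 / 2) : n = 0 := by
      have : |(n : ℝ)| < 1 := by linarith
      exact Int.abs_lt_one_iff.1 (by exact_mod_cast this)
    have h3 : latticePt p = 0 := by simp [latticePt, key _ h1.1, key _ h1.2]
    rw [Set.mem_ofPred_eq, h3, norm_zero] at h2
    norm_num at h2
  refine ⟨W w, hwpos, fun z hz => ?_⟩
  -- The weighted modulus `W` is lattice-periodic, so its minimum over `K` bounds it on all of
  -- `farFromLattice`.
  have h1 : W z = W (z - latticePt (roundPt z)) := by
    have := (isSigmaPeriod_latticePt (roundPt z)).weight_add (z - latticePt (roundPt z))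
    rwa [sub_add_cancel] at this
  have h2 : W w ≤ W z := h1 ▸ hw ⟨sub_roundPt_mem z, hz _⟩
  calc W w * Real.exp (Real.pi / 2 * ‖z‖ ^ 2) ≤ W z * Real.exp (Real.pi / 2 * ‖z‖ ^ 2) := by
        gcongr
    _ = ‖gaussSigma z‖ := by
        simp only [W]
        rw [mul_assoc, ← Real.exp_add]
        simp

/-! ### Partial fractions over the lattice -/

lemma normSq_latticePt (p : ℤ × ℤ) : ‖latticePt p‖ ^ 2 = (p.1 : ℝ) ^ 2 + (p.2 : ℝ) ^ 2 := by
  rw [← Complex.normSq_eq_norm_sq, Complex.normSq_apply, latticePt_re, latticePt_im]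
  ring

lemma summable_exp_neg_int_sq {c : ℝ} (hc : 0 < c) :
    Summable fun n : ℤ => Real.exp (-c * (n : ℝ) ^ 2) := by
  have h : Summable fun n : ℕ => Real.exp (-c * (n : ℝ) ^ 2) := by
    refine Summable.of_nonneg_of_le (fun _ => (Real.exp_pos _).le) (fun n => ?_)
      (summable_geometric_of_lt_one (Real.exp_pos (-c)).le (by simpa using hc))
    rw [← Real.exp_nat_mul]
    refine Real.exp_le_exp.2 ?_
    have : (n : ℝ) ≤ (n : ℝ) ^ 2 := by exact_mod_cast Nat.le_self_pow two_ne_zero n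
    nlinarith
  refine Summable.of_nat_of_neg (by simpa using h) (by simpa using h)

lemma summable_exp_neg_latticePt {c : ℝ} (hc : 0 < c) :
    Summable fun p : ℤ × ℤ => Real.exp (-c * ‖latticePt p‖ ^ 2) := by
  have h := summable_exp_neg_int_sq hc
  refine (h.mul_of_nonneg h (fun _ => (Real.exp_pos _).le) (fun _ => (Real.exp_pos _).le)).congr
    fun p => ?_
  rw [normSq_latticePt, mul_add, Real.exp_add]

/-- The lattice points of coordinates at most `N` in absolute value. -/
noncomputable def latticeBox (N : ℕ) : Finset (ℤ × ℤ) :=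
  Finset.Icc (-(N : ℤ)) N ×ˢ Finset.Icc (-(N : ℤ)) N

lemma mem_latticeBox {N : ℕ} {p : ℤ × ℤ} (hp : latticePt p ∈ openSquare (N + 1)) :
    p ∈ latticeBox N := by
  rw [mem_openSquare, latticePt_re, latticePt_im, abs_lt, abs_lt] at hp
  obtain ⟨⟨h1, h2⟩, h3, h4⟩ := hp
  have h1' : -((N : ℤ) + 1) < p.1 := by exact_mod_cast h1
  have h2' : p.1 < (N : ℤ) + 1 := by exact_mod_cast h2
  have h3' : -((N : ℤ) + 1) < p.2 := by exact_mod_cast h3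
  have h4' : p.2 < (N : ℤ) + 1 := by exact_mod_cast h4
  simp only [latticeBox, Finset.mem_product, Finset.mem_Icc]
  omega

lemma latticePt_injective : Function.Injective latticePt := fun p q h => by
  have h1 := congrArg Complex.re h
  have h2 := congrArg Complex.im h
  rw [latticePt_re, latticePt_re] at h1
  rw [latticePt_im, latticePt_im] at h2
  exact Prod.ext (by exact_mod_cast h1) (by exact_mod_cast h2)

lemma deriv_gaussSigma_latticePt_ne (p : ℤ × ℤ) : deriv gaussSigma (latticePt p) ≠ 0 := by
  rw [← norm_pos_iff, norm_deriv_gaussSigma_latticePt]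
  exact mul_pos (Real.exp_pos _) (norm_pos_iff.2 deriv_gaussSigma_zero_ne)

/-- The partial sums of the partial fraction expansion of `F / gaussSigma`. -/
noncomputable def partialFraction (F : ℂ → ℂ) (N : ℕ) (z : ℂ) : ℂ :=
  ∑ p ∈ latticeBox N, F (latticePt p) / (deriv gaussSigma (latticePt p) * (z - latticePt p))

/-- The sum bounding the partial fraction expansion. -/
noncomputable def latticeGaussSum : ℝ :=
  ∑' p : ℤ × ℤ, Real.exp (-(Real.pi / 2) * ‖latticePt p‖ ^ 2)

/-- The distance 1/2 from the lattice gives the factor 2, and the growth of `σ'` at lattice points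
leaves a convergent Gaussian sum, so the bound is independent of `N`. -/
lemma norm_partialFraction_le {F : ℂ → ℂ} {M : ℝ} (hM : ∀ p, ‖F (latticePt p)‖ ≤ M) (N : ℕ) {z : ℂ}
    (hz : z ∈ farFromLattice) :
    ‖partialFraction F N z‖ ≤ M * (2 / ‖deriv gaussSigma 0‖ * latticeGaussSum) := by
  have hM0 : 0 ≤ M := (norm_nonneg _).trans (hM 0)
  have hD : 0 < ‖deriv gaussSigma 0‖ := norm_pos_iff.2 deriv_gaussSigma_zero_ne
  have hterm (p : ℤ × ℤ) :
      ‖F (latticePt p) / (deriv gaussSigma (latticePt p) * (z - latticePt p))‖ ≤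
        M * (2 / ‖deriv gaussSigma 0‖) * Real.exp (-(Real.pi / 2) * ‖latticePt p‖ ^ 2) := by
    rw [norm_div, norm_mul, norm_deriv_gaussSigma_latticePt, neg_mul, Real.exp_neg]
    have h1 := hz p
    calc _ ≤ M / (Real.exp (Real.pi / 2 * ‖latticePt p‖ ^ 2) * ‖deriv gaussSigma 0‖ * (1 / 2)) := by
          gcongr
          exact hM p
      _ = _ := by field_simp
  calc _ ≤ ∑ p ∈ latticeBox N,
        M * (2 / ‖deriv gaussSigma 0‖) * Real.exp (-(Real.pi / 2) * ‖latticePt p‖ ^ 2) :=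
        norm_sum_le_of_le _ fun p _ => hterm p
    _ = M * (2 / ‖deriv gaussSigma 0‖) *
        ∑ p ∈ latticeBox N, Real.exp (-(Real.pi / 2) * ‖latticePt p‖ ^ 2) := by
        rw [Finset.mul_sum]
    _ ≤ M * (2 / ‖deriv gaussSigma 0‖) * latticeGaussSum := by
        gcongr
        exact (summable_exp_neg_latticePt (by positivity)).sum_le_tsum _
          fun _ _ => (Real.exp_pos _).le
    _ = _ := by ring

/-- The half-side `N + 1` makes the open square contain exactly the lattice points of the box, with
room for the closed square of half-side `N + 1/2`. -/
lemma exists_sub_partialFraction {F : ℂ → ℂ} (hF : Differentiable ℂ F) (N : ℕ) :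
    ∃ h : ℂ → ℂ, DifferentiableOn ℂ h (openSquare (N + 1)) ∧
      ∀ z ∈ openSquare (N + 1), z ∈ farFromLattice →
        F z = gaussSigma z * (partialFraction F N z + h z) := by
  -- `S` is the entire interpolant `σ · partialFraction`: it agrees with `F` at the lattice points
  -- of the box, so `σ` divides `F - S` on the square.
  set S : ℂ → ℂ := fun z => ∑ p ∈ latticeBox N,
    F (latticePt p) / deriv gaussSigma (latticePt p) * dslope gaussSigma (latticePt p) z with hS
  have hds (p : ℤ × ℤ) : Differentiable ℂ (dslope gaussSigma (latticePt p)) := by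
    rw [← differentiableOn_univ, Complex.differentiableOn_dslope Filter.univ_mem]
    exact differentiable_gaussSigma.differentiableOn
  have hSd : Differentiable ℂ S := by
    rw [hS]
    exact Differentiable.fun_sum fun p _ => (hds p).const_mul _
  obtain ⟨h, hh, hmul⟩ := exists_differentiableOn_eq_mul (isOpen_openSquare (N + 1))
    (hF.sub hSd).differentiableOn differentiable_gaussSigma.differentiableOn (by
      intro z hz hz0
      obtain ⟨p, rfl⟩ := (gaussSigma_eq_zero_iff z).1 hz0
      refine ⟨?_, deriv_gaussSigma_latticePt_ne p⟩
      rw [Pi.sub_apply, hS]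
      simp only
      rw [Finset.sum_eq_single p]
      · rw [dslope_same, div_mul_cancel₀ _ (deriv_gaussSigma_latticePt_ne p), sub_self]
      · intro q _ hqp
        rw [dslope_of_ne _ (latticePt_injective.ne hqp.symm), slope_def_field, hz0,
          (gaussSigma_eq_zero_iff _).2 ⟨q, rfl⟩, sub_zero, zero_div, mul_zero]
      · exact fun hp => absurd (mem_latticeBox hz) hp)
  refine ⟨h, hh, fun z hz hfar => ?_⟩
  have h1 := hmul z hz
  have h2 : S z = gaussSigma z * partialFraction F N z := by
    simp only [hS, partialFraction, Finset.mul_sum]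
    refine Finset.sum_congr rfl fun p _ => ?_
    have hne : z ≠ latticePt p := by
      rintro rfl
      have := hfar p
      norm_num at this
    rw [dslope_of_ne _ hne, slope_def_field, (gaussSigma_eq_zero_iff _).2 ⟨p, rfl⟩, sub_zero]
    have := deriv_gaussSigma_latticePt_ne p
    have := sub_ne_zero.2 hne
    field_simp
  rw [Pi.sub_apply, h2] at h1
  linear_combination h1

/-! ### Sampling inequality and Liouville theorem -/

/-- Sampling inequality on the unit cell for entire functions of small Gaussian growth. -/
lemma exists_norm_le_mul_of_lattice_bound : ∃ K : ℝ, ∀ (F : ℂ → ℂ) (M C c : ℝ),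
    Differentiable ℂ F → c < Real.pi / 2 → (∀ z, ‖F z‖ ≤ C * Real.exp (c * ‖z‖ ^ 2)) →
    (∀ p, ‖F (latticePt p)‖ ≤ M) → ∀ z ∈ closure (openSquare (1 / 2)), ‖F z‖ ≤ K * M := by
  obtain ⟨δ, hδ, hsig⟩ := exists_le_norm_gaussSigma
  obtain ⟨B, hB⟩ := (isCompact_closure_openSquare (1 / 2)).exists_bound_of_continuousOn
    differentiable_gaussSigma.continuous.continuousOn
  set T := 2 / ‖deriv gaussSigma 0‖ * latticeGaussSum
  -- `B` bounds `σ` on the cell; one `T` pays for the partial fraction, the other for the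
  -- holomorphic remainder. `C` and `c` do not enter.
  refine ⟨B * (2 * T), fun F M C c hF hc hgrow hM => ?_⟩
  have hB0 : 0 ≤ B := (norm_nonneg _).trans (hB 0 (by
    rw [mem_closure_openSquare (by norm_num)]
    norm_num))
  have hC : 0 ≤ C := by simpa using (norm_nonneg _).trans (hgrow 0)
  have hhalf : ((0 : ℕ) : ℝ) + 1 / 2 = 1 / 2 := by norm_num
  -- A bound for `F/σ` on the boundary of the `N`-th square, where `|z|² ≥ N`.
  set ε : ℕ → ℝ := fun N => C / δ * Real.exp (-((Real.pi / 2 - c) * (N : ℝ))) with hε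
  have hfront : ∀ z ∈ frontier (openSquare (1 / 2)), ‖F z‖ ≤ B * (2 * T) * M := by
    intro w hw
    have hwfar : w ∈ farFromLattice := frontier_subset_far 0 (hhalf.symm ▸ hw)
    have hwcl : w ∈ closure (openSquare (1 / 2)) := frontier_subset_closure hw
    have hwsq := (mem_closure_openSquare (by norm_num)).1 hwcl
    have hstep (N : ℕ) : ‖F w‖ ≤ B * (2 * (M * T) + ε N) := by
      obtain ⟨h, hh, hmul⟩ := exists_sub_partialFraction hF N
      have hsub : closure (openSquare (N + 1 / 2)) ⊆ openSquare (N + 1) := fun z hz => by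
        rw [mem_closure_openSquare (by positivity)] at hz
        rw [mem_openSquare]
        constructor <;> linarith [hz.1, hz.2]
      have hbd : ∀ z ∈ frontier (openSquare (N + 1 / 2)), ‖h z‖ ≤ M * T + ε N := by
        intro z hz
        have hfar := frontier_subset_far N hz
        have h1 := hmul z (hsub (frontier_subset_closure hz)) hfar
        have hlow := hsig z hfar
        have hpos : 0 < ‖gaussSigma z‖ := lt_of_lt_of_le (by positivity) hlow
        have h2 : h z = F z / gaussSigma z - partialFraction F N z := by
          rw [h1, mul_div_cancel_left₀ _ (norm_pos_iff.1 hpos), add_sub_cancel_left]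
        have h3 : ‖F z / gaussSigma z‖ ≤ ε N := by
          rw [norm_div]
          calc _ ≤ C * Real.exp (c * ‖z‖ ^ 2) / (δ * Real.exp (Real.pi / 2 * ‖z‖ ^ 2)) := by
                gcongr
                exact hgrow z
            _ = C / δ * Real.exp (-((Real.pi / 2 - c) * ‖z‖ ^ 2)) := by
                rw [mul_div_mul_comm, ← Real.exp_sub]
                ring_nf
            _ ≤ ε N := by
                have hN := le_norm_of_mem_frontier N hz
                have hNz : (N : ℝ) ≤ ‖z‖ ^ 2 := by
                  have : (0 : ℝ) ≤ N := N.cast_nonneg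
                  nlinarith
                exact mul_le_mul_of_nonneg_left (Real.exp_le_exp.2 (neg_le_neg
                  (mul_le_mul_of_nonneg_left hNz (by linarith)))) (by positivity)
        rw [h2]
        linarith [norm_sub_le (F z / gaussSigma z) (partialFraction F N z),
          norm_partialFraction_le hM N hfar]
      have hwN : w ∈ closure (openSquare (N + 1 / 2)) := by
        rw [mem_closure_openSquare (by positivity)]
        have : (0 : ℝ) ≤ N := N.cast_nonneg
        constructor <;> linarith [hwsq.1, hwsq.2]
      -- The remainder has no poles, so its boundary bound passes to the small cell.
      have hhw : ‖h w‖ ≤ M * T + ε N :=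
        Complex.norm_le_of_forall_mem_frontier_norm_le (isBounded_openSquare _)
          (DifferentiableOn.diffContOnCl (hh.mono hsub)) hbd hwN
      rw [hmul w (hsub hwN) hwfar, norm_mul]
      gcongr
      · exact hB w hwcl
      · linarith [norm_add_le (partialFraction F N w) (h w), norm_partialFraction_le hM N hwfar]
    have hlim : Filter.Tendsto (fun N => B * (2 * (M * T) + ε N)) Filter.atTop
        (nhds (B * (2 * (M * T) + C / δ * 0))) := by
      refine (((Real.tendsto_exp_neg_atTop_nhds_zero.comp ?_).const_mul _).const_add _).const_mul _
      exact tendsto_natCast_atTop_atTop.const_mul_atTop (by linarith)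
    have := ge_of_tendsto' hlim hstep
    linarith
  exact fun z hz => Complex.norm_le_of_forall_mem_frontier_norm_le (isBounded_openSquare _)
    hF.diffContOnCl hfront hz

/-- An entire function of Gaussian growth below the critical type that is bounded on the Gaussian
integers is constant. -/
theorem eq_of_bounded_on_latticePt {F : ℂ → ℂ} {M C c : ℝ} (hF : Differentiable ℂ F) (hc0 : 0 ≤ c)
    (hc : c < Real.pi / 2) (hgrow : ∀ z, ‖F z‖ ≤ C * Real.exp (c * ‖z‖ ^ 2))
    (hM : ∀ p, ‖F (latticePt p)‖ ≤ M) (z w : ℂ) : F z = F w := by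
  obtain ⟨K, hK⟩ := exists_norm_le_mul_of_lattice_bound
  have hC : 0 ≤ C := by simpa using (norm_nonneg _).trans (hgrow 0)
  -- Translating `F` by a lattice point raises its growth rate slightly; `d` leaves room for this
  -- below the critical type. The enlarged constant is harmless, since `K` does not depend on it.
  obtain ⟨d, hcd, hd⟩ := exists_between hc
  have hbound (z : ℂ) : ‖F z‖ ≤ K * M := by
    set q := roundPt z
    set R := ‖latticePt q‖
    -- The constant comes from completing the square in `c(|u| + R)² ≤ d|u|² + (cd/(d - c))R²`.
    have h := hK (fun u => F (u + latticePt q)) M (C * Real.exp (c * d / (d - c) * R ^ 2)) d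
      (by fun_prop) hd (fun u => ?_) (fun p => ?_) _ (sub_roundPt_mem z)
    · simpa only [q, sub_add_cancel] using h
    · refine (hgrow _).trans ?_
      rw [mul_assoc, ← Real.exp_add]
      gcongr
      have hdc : 0 < d - c := sub_pos.2 hcd
      have h1 : ‖u + latticePt q‖ ^ 2 ≤ (‖u‖ + R) ^ 2 := by
        gcongr
        exact norm_add_le _ _
      have h2 : c * d / (d - c) * R ^ 2 + d * ‖u‖ ^ 2 - c * (‖u‖ + R) ^ 2 =
          ((d - c) * ‖u‖ - c * R) ^ 2 / (d - c) := by
        field_simp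
        ring
      have h3 : 0 ≤ ((d - c) * ‖u‖ - c * R) ^ 2 / (d - c) := by positivity
      nlinarith
    · have : latticePt p + latticePt q = latticePt (p + q) := by
        simp [latticePt]
        ring
      simp only [this]
      exact hM _
  exact hF.apply_eq_apply_of_bounded
    (isBounded_iff_forall_norm_le.2 ⟨K * M, by rintro _ ⟨z, rfl⟩; exact hbound z⟩) z w

/-! ### Uniqueness for the Fourier transform -/

/-- An integrable function on `ℝ` with vanishing Fourier transform vanishes almost everywhere. -/
lemma ae_eq_zero_of_fourier_eq_zero {g : ℝ → ℂ} (hg : Integrable g)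
    (h : ∀ ω : ℝ,
      ∫ t : ℝ, Complex.exp (-2 * (Real.pi : ℂ) * Complex.I * (t : ℂ) * (ω : ℂ)) * g t = 0) :
    ∀ᵐ t, g t = 0 := by
  open FourierTransform in
  have hF : 𝓕 g = 0 := by
    ext ω
    rw [Real.fourier_eq', Pi.zero_apply, ← h ω]
    refine integral_congr_ae (.of_forall fun t => ?_)
    simp only [smul_eq_mul]
    congr 2
    simp
    ring
  refine ae_eq_zero_of_integral_contDiff_smul_eq_zero hg.locallyIntegrable fun χ hχ hχc => ?_
  have hc : HasCompactSupport (Complex.ofRealCLM ∘ χ) := hχc.comp_left rfl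
  have hd : ContDiff ℝ (⊤ : ℕ∞) (Complex.ofRealCLM ∘ χ) := Complex.ofRealCLM.contDiff.comp hχ
  -- Each test function is the Fourier transform of a Schwartz function `ψ`; moving the transform
  -- onto `g` makes the pairing vanish.
  open FourierTransform in
  set ψ : SchwartzMap ℝ ℂ := 𝓕⁻ (hc.toSchwartzMap hd) with hψ
  have key := VectorFourier.integral_fourierIntegral_smul_eq_flip (L := innerₗ ℝ)
    (μ := volume) (ν := volume) Real.continuous_fourierChar continuous_inner ψ.integrable hg
  have hflip : VectorFourier.fourierIntegral Real.fourierChar volume (innerₗ ℝ).flip g = 0 := by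
    rw [flip_innerₗ]
    exact hF
  rw [hflip] at key
  simp only [Pi.zero_apply, smul_zero, integral_zero] at key
  rw [← key]
  refine integral_congr_ae (.of_forall fun t => ?_)
  simp only
  open FourierTransform in
  have h1 : 𝓕 ψ = hc.toSchwartzMap hd := by rw [hψ, FourierTransform.fourier_fourierInv_eq]
  have h2 : VectorFourier.fourierIntegral Real.fourierChar volume (innerₗ ℝ) (ψ : ℝ → ℂ) t =
      (χ t : ℂ) := by
    have := congrArg (fun φ : SchwartzMap ℝ ℂ => φ t) h1
    simpa [SchwartzMap.fourier_coe] using! this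
  rw [h2, Complex.real_smul, smul_eq_mul]

/-! ### Bargmann and Fock transforms -/

/-- The kernel of the Bargmann transform, up to normalization. -/
noncomputable def bargmannKernel (z : ℂ) (t : ℝ) : ℂ :=
  Complex.exp (-Real.pi * (t : ℂ) ^ 2 + 2 * Real.pi * t * z)

/-- The Bargmann transform, without its Gaussian prefactor. -/
noncomputable def bargmann (f : ℝ → ℂ) (z : ℂ) : ℂ :=
  (((2 : ℝ) ^ (1 / 4 : ℝ) : ℝ) : ℂ) * ∫ t : ℝ, f t * bargmannKernel z t

lemma norm_bargmannKernel (z : ℂ) (t : ℝ) :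
    ‖bargmannKernel z t‖ = Real.exp (-Real.pi * t ^ 2 + 2 * Real.pi * t * z.re) := by
  rw [bargmannKernel, Complex.norm_exp]
  congr 1
  simp [← Complex.ofReal_pow]

lemma continuous_bargmannKernel (z : ℂ) : Continuous (bargmannKernel z) := by
  unfold bargmannKernel
  fun_prop

lemma memLp_exp_neg_mul_sq {b : ℝ} (hb : 0 < b) :
    MemLp (fun t : ℝ => Real.exp (-b * t ^ 2)) 2 volume := by
  rw [memLp_two_iff_integrable_sq (by fun_prop)]
  refine (integrable_exp_neg_mul_sq (b := 2 * b) (by positivity)).congr (.of_forall fun t => ?_)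
  simp only
  rw [← Real.exp_nat_mul]
  congr 1
  push_cast
  ring

lemma integrable_norm_mul_gaussian {f : ℝ → ℂ} (hf : MemLp f 2 volume) {b : ℝ} (hb : 0 < b) :
    Integrable fun t => ‖f t‖ * Real.exp (-b * t ^ 2) :=
  hf.norm.integrable_mul (memLp_exp_neg_mul_sq hb)

/-- Expand `(|t| - 2s)² ≥ 0`: half of the Gaussian decay absorbs the linear term. -/
lemma gaussian_exponent_le {t s R : ℝ} (hs : |s| ≤ R) :
    -Real.pi * t ^ 2 + 2 * Real.pi * |t| * s ≤
      2 * Real.pi * R ^ 2 + -(Real.pi / 2) * t ^ 2 := by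
  have h1 : s ^ 2 ≤ R ^ 2 := sq_le_sq.2 (hs.trans (le_abs_self R))
  have h2 : 0 ≤ Real.pi * (|t| - 2 * s) ^ 2 := by positivity
  have h3 := mul_le_mul_of_nonneg_left h1 Real.pi_pos.le
  rw [← sq_abs t]
  nlinarith

lemma norm_bargmannKernel_le (z : ℂ) (t : ℝ) : ‖bargmannKernel z t‖ ≤
    Real.exp (2 * Real.pi * z.re ^ 2) * Real.exp (-(Real.pi / 2) * t ^ 2) := by
  rw [norm_bargmannKernel, ← Real.exp_add, Real.exp_le_exp]
  have := gaussian_exponent_le (t := t) (le_refl |(|z.re|)|)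
  rw [abs_abs, sq_abs] at this
  refine le_trans ?_ this
  gcongr -Real.pi * t ^ 2 + ?_
  calc 2 * Real.pi * t * z.re = 2 * Real.pi * (t * z.re) := by ring
    _ ≤ 2 * Real.pi * |t * z.re| := by gcongr; exact le_abs_self _
    _ = _ := by rw [abs_mul]; ring

lemma integrable_mul_bargmannKernel {f : ℝ → ℂ} (hf : MemLp f 2 volume) (z : ℂ) :
    Integrable fun t => f t * bargmannKernel z t := by
  refine Integrable.mono' ((integrable_norm_mul_gaussian hf (b := Real.pi / 2)
    (by positivity)).const_mul (Real.exp (2 * Real.pi * z.re ^ 2)))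
    (hf.aestronglyMeasurable.mul (continuous_bargmannKernel z).aestronglyMeasurable)
    (.of_forall fun t => ?_)
  rw [norm_mul, mul_left_comm]
  gcongr
  exact norm_bargmannKernel_le z t

lemma differentiable_bargmann {f : ℝ → ℂ} (hf : MemLp f 2 volume) :
    Differentiable ℂ (bargmann f) := by
  intro z₀
  -- One unit covers the ball around `z₀`, the other absorbs the factor `2πt` of the derivative,
  -- bounded by `e^{2π|t|}`.
  set R := ‖z₀‖ + 2
  have h := hasDerivAt_integral_of_dominated_loc_of_deriv_le (μ := volume) (𝕜 := ℂ)
    (F := fun z t => f t * bargmannKernel z t)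
    (F' := fun z t => f t * (bargmannKernel z t * (2 * Real.pi * t)))
    (bound := fun t => Real.exp (2 * Real.pi * R ^ 2) *
      (‖f t‖ * Real.exp (-(Real.pi / 2) * t ^ 2)))
    (Metric.ball_mem_nhds z₀ one_pos)
    (.of_forall fun z => (integrable_mul_bargmannKernel hf z).aestronglyMeasurable)
    (integrable_mul_bargmannKernel hf z₀)
    (hf.aestronglyMeasurable.mul
      ((continuous_bargmannKernel z₀).mul (by fun_prop)).aestronglyMeasurable)
    (.of_forall fun t z hz => ?_)
    ((integrable_norm_mul_gaussian hf (by positivity)).const_mul _)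
    (.of_forall fun t z _ => ?_)
  · exact (h.2.const_mul _).differentiableAt
  · rw [norm_mul, norm_mul, norm_bargmannKernel, mul_left_comm (Real.exp _), ← Real.exp_add]
    gcongr
    have h1 : ‖(2 * Real.pi * t : ℂ)‖ ≤ Real.exp (2 * Real.pi * |t|) := by
      rw [norm_mul, norm_mul, Complex.norm_ofNat, Complex.norm_real, Complex.norm_real,
        Real.norm_of_nonneg Real.pi_pos.le, Real.norm_eq_abs]
      linarith [Real.add_one_le_exp (2 * Real.pi * |t|)]
    have hz1 : |z.re| + 1 ≤ R := by
      have h2 := Complex.abs_re_le_norm z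
      have h3 : ‖z - z₀‖ < 1 := mem_ball_iff_norm.1 hz
      have h4 := norm_sub_norm_le z z₀
      simp only [R]
      linarith
    calc _ ≤ Real.exp (-Real.pi * t ^ 2 + 2 * Real.pi * t * z.re) * Real.exp (2 * Real.pi * |t|) :=
          by gcongr
      _ ≤ Real.exp (-Real.pi * t ^ 2 + 2 * Real.pi * |t| * (|z.re| + 1)) := by
          rw [← Real.exp_add, Real.exp_le_exp]
          have h5 : t * z.re ≤ |t| * |z.re| := abs_mul t z.re ▸ le_abs_self _
          nlinarith [mul_le_mul_of_nonneg_left h5 Real.pi_pos.le]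
      _ ≤ _ := Real.exp_le_exp.2 (gaussian_exponent_le (by rwa [abs_of_nonneg (by positivity)]))
  · have h1 : HasDerivAt (fun z : ℂ => -Real.pi * (t : ℂ) ^ 2 + 2 * Real.pi * t * z)
        (2 * Real.pi * t : ℂ) z := by
      simpa using ((hasDerivAt_id z).const_mul (2 * Real.pi * t : ℂ)).const_add
        (-Real.pi * (t : ℂ) ^ 2)
    exact h1.cexp.const_mul (f t)

lemma gaborTransform_eq_bargmann (f : ℝ → ℂ) (x ω : ℝ) :
    gaborTransform f x ω = Complex.exp (-Real.pi * (x : ℂ) ^ 2) * bargmann f (x - Complex.I * ω) := by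
  rw [gaborTransform, bargmann, mul_left_comm]
  congr 1
  rw [← integral_const_mul]
  refine integral_congr_ae (.of_forall fun t => ?_)
  simp only
  rw [bargmannKernel, mul_assoc, mul_left_comm (Complex.exp _), ← Complex.exp_add,
    Complex.ofReal_exp, ← Complex.exp_add]
  congr 2
  push_cast
  ring

/-- The entire function in the Bargmann–Fock space whose modulus is the Gabor magnitude divided by
a Gaussian. -/
noncomputable def fockTransform (f : ℝ → ℂ) (z : ℂ) : ℂ :=
  bargmann f z * Complex.exp (-(Real.pi / 2) * z ^ 2)

lemma differentiable_fockTransform {f : ℝ → ℂ} (hf : MemLp f 2 volume) :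
    Differentiable ℂ (fockTransform f) :=
  (differentiable_bargmann hf).mul (by fun_prop)

lemma norm_fockTransform (f : ℝ → ℂ) (z : ℂ) :
    ‖fockTransform f z‖ = ‖gaborTransform f z.re (-z.im)‖ * Real.exp (Real.pi / 2 * ‖z‖ ^ 2) := by
  have h1 : ((z.re : ℝ) : ℂ) - Complex.I * ((-z.im : ℝ) : ℂ) = z := by
    apply Complex.ext <;> simp
  rw [fockTransform, gaborTransform_eq_bargmann, h1, norm_mul, norm_mul, Complex.norm_exp,
    Complex.norm_exp, mul_comm (Real.exp _) ‖bargmann f z‖, mul_assoc, ← Real.exp_add]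
  congr 2
  rw [← Complex.normSq_eq_norm_sq, Complex.normSq_apply]
  simp [pow_two, Complex.mul_re, -Complex.ofReal_neg]
  ring

/-- The inequality `2uv ≤ u² + v²` under the integral, with translation invariance, gives a bound
uniform in `(x, ω)`. This supplies the growth bound for `fockTransform f`. -/
lemma exists_norm_gaborTransform_le {f : ℝ → ℂ} (hf : MemLp f 2 volume) :
    ∃ C, ∀ x ω, ‖gaborTransform f x ω‖ ≤ C := by
  refine ⟨(2 : ℝ) ^ (1 / 4 : ℝ) *
    (((∫ t, ‖f t‖ ^ 2) + ∫ t : ℝ, Real.exp (-(2 * Real.pi) * t ^ 2)) / 2), fun x ω => ?_⟩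
  have hg : Integrable fun t : ℝ => Real.exp (-(2 * Real.pi) * t ^ 2) :=
    integrable_exp_neg_mul_sq (by positivity)
  have hf2 : Integrable fun t => ‖f t‖ ^ 2 :=
    (memLp_two_iff_integrable_sq_norm hf.aestronglyMeasurable).1 hf
  rw [gaborTransform, norm_mul, Complex.norm_real, Real.norm_of_nonneg (by positivity)]
  gcongr
  have hbound (t : ℝ) : ‖f t * ((Real.exp (-Real.pi * (t - x) ^ 2) : ℝ) : ℂ) *
      Complex.exp (-2 * (Real.pi : ℂ) * Complex.I * (t : ℂ) * (ω : ℂ))‖ ≤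
      (‖f t‖ ^ 2 + Real.exp (-(2 * Real.pi) * (t - x) ^ 2)) / 2 := by
    have h1 : ‖Complex.exp (-2 * (Real.pi : ℂ) * Complex.I * (t : ℂ) * (ω : ℂ))‖ = 1 := by
      simp [Complex.norm_exp]
    rw [norm_mul, norm_mul, h1, mul_one, Complex.norm_real, Real.norm_of_nonneg (by positivity)]
    have h2 : Real.exp (-(2 * Real.pi) * (t - x) ^ 2) = Real.exp (-Real.pi * (t - x) ^ 2) ^ 2 := by
      rw [← Real.exp_nat_mul]
      congr 1
      push_cast
      ring
    rw [h2]
    linarith [two_mul_le_add_sq ‖f t‖ (Real.exp (-Real.pi * (t - x) ^ 2))]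
  calc _ ≤ ∫ t, (‖f t‖ ^ 2 + Real.exp (-(2 * Real.pi) * (t - x) ^ 2)) / 2 :=
        norm_integral_le_of_norm_le ((hf2.add (hg.comp_sub_right x)).div_const 2)
          (.of_forall hbound)
    _ = _ := by
        rw [integral_div, integral_add hf2 (hg.comp_sub_right x),
          integral_sub_right_eq_self (fun t : ℝ => Real.exp (-(2 * Real.pi) * t ^ 2)) x]

lemma memLp_normalizedGaussian : MemLp normalizedGaussian 2 volume :=
  ((memLp_exp_neg_mul_sq Real.pi_pos).const_mul ((2 : ℝ) ^ (1 / 4 : ℝ))).ofReal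

lemma bargmann_normalizedGaussian (z : ℂ) :
    bargmann normalizedGaussian z = Complex.exp (Real.pi / 2 * z ^ 2) := by
  have hpi : (Real.pi : ℂ) ≠ 0 := by exact_mod_cast Real.pi_ne_zero
  have h1 := fourierIntegral_gaussian (b := 2 * Real.pi) (by simp [Real.pi_pos])
    (-2 * Real.pi * Complex.I * z)
  -- The normalizations of the transform and of the Gaussian cancel the factor `2^{-1/2}` of the
  -- Gaussian integral.
  have h2 : ((2 : ℝ) ^ (1 / 4 : ℝ)) * (2 : ℝ) ^ (1 / 4 : ℝ) * ((1 / 2 : ℝ) ^ (1 / 2 : ℝ)) = 1 := by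
    rw [← Real.rpow_add two_pos, one_div (2 : ℝ), Real.inv_rpow two_pos.le]
    norm_num
  have h3 : ((Real.pi : ℂ) / (2 * Real.pi)) ^ (1 / 2 : ℂ) = (((1 / 2 : ℝ) ^ (1 / 2 : ℝ) : ℝ) : ℂ) := by
    rw [Complex.ofReal_cpow (by norm_num)]
    congr 1
    · field_simp
      simp
    · simp
  have h4 : -(-2 * Real.pi * Complex.I * z) ^ 2 / (4 * (2 * Real.pi)) = Real.pi / 2 * z ^ 2 := by
    field_simp
    linear_combination (-4 * z ^ 2) * Complex.I_sq
  rw [h3, h4] at h1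
  have h5 : ∫ t : ℝ, normalizedGaussian t * bargmannKernel z t =
      (((2 : ℝ) ^ (1 / 4 : ℝ) : ℝ) : ℂ) * ((((1 / 2 : ℝ) ^ (1 / 2 : ℝ) : ℝ) : ℂ) *
        Complex.exp (Real.pi / 2 * z ^ 2)) := by
    rw [← h1, ← integral_const_mul]
    congr 1
    ext t
    rw [normalizedGaussian, bargmannKernel, Complex.ofReal_mul, mul_assoc, Complex.ofReal_exp,
      ← Complex.exp_add, ← Complex.exp_add]
    congr 2
    push_cast
    linear_combination (2 * Real.pi * z * t) * Complex.I_sq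
  rw [bargmann, h5, ← mul_assoc, ← mul_assoc, ← Complex.ofReal_mul, ← Complex.ofReal_mul, h2,
    Complex.ofReal_one, one_mul]

lemma fockTransform_normalizedGaussian (z : ℂ) : fockTransform normalizedGaussian z = 1 := by
  rw [fockTransform, bargmann_normalizedGaussian, ← Complex.exp_add]
  simp

lemma norm_gaborTransform_sq_iff (f : ℝ → ℂ) (x ω : ℝ) :
    ‖gaborTransform f x ω‖ ^ 2 = Real.exp (-Real.pi * (x ^ 2 + ω ^ 2)) ↔
      ‖fockTransform f (x - ω * Complex.I)‖ = 1 := by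
  have hn : ‖(x - ω * Complex.I : ℂ)‖ ^ 2 = x ^ 2 + ω ^ 2 := by
    rw [← Complex.normSq_eq_norm_sq, Complex.normSq_apply]
    simp
    ring
  have h : ‖fockTransform f (x - ω * Complex.I)‖ ^ 2 =
      ‖gaborTransform f x ω‖ ^ 2 * Real.exp (Real.pi * (x ^ 2 + ω ^ 2)) := by
    rw [norm_fockTransform, mul_pow, hn, ← Real.exp_nat_mul]
    congr 2
    · simp
    · push_cast
      ring
  rw [← pow_eq_one_iff_of_nonneg (norm_nonneg (fockTransform f _)) two_ne_zero, h, neg_mul,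
    Real.exp_neg, ← one_div, eq_div_iff (Real.exp_ne_zero _)]

/-- The Bargmann transform is injective on `L²`. -/
lemma ae_eq_of_bargmann_eq {f g : ℝ → ℂ} (hf : MemLp f 2 volume) (hg : MemLp g 2 volume)
    (h : ∀ z, bargmann f z = bargmann g z) : f =ᵐ[volume] g := by
  have hint := (integrable_mul_bargmannKernel hf 0).sub (integrable_mul_bargmannKernel hg 0)
  have h2 : (((2 : ℝ) ^ (1 / 4 : ℝ) : ℝ) : ℂ) ≠ 0 := by
    exact_mod_cast (Real.rpow_pos_of_pos two_pos _).ne'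
  have := ae_eq_zero_of_fourier_eq_zero hint fun ω => by
    -- On the imaginary axis the Bargmann transform is the Fourier transform of `f(t) e^{-πt²}`, up
    -- to a constant.
    have h1 := mul_left_cancel₀ h2 (h (-Complex.I * ω))
    rw [← sub_eq_zero, ← integral_sub (integrable_mul_bargmannKernel hf _)
      (integrable_mul_bargmannKernel hg _)] at h1
    refine (integral_congr_ae (.of_forall fun t => ?_)).trans h1
    have hk : Complex.exp (-2 * (Real.pi : ℂ) * Complex.I * (t : ℂ) * (ω : ℂ)) *
        bargmannKernel 0 t = bargmannKernel (-Complex.I * ω) t := by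
      rw [bargmannKernel, bargmannKernel, ← Complex.exp_add]
      congr 1
      ring
    rw [← hk, Pi.sub_apply]
    ring
  filter_upwards [this] with t ht
  rw [Pi.sub_apply, ← sub_mul, mul_eq_zero] at ht
  exact sub_eq_zero.1 (ht.resolve_right (Complex.exp_ne_zero _))

/-! ### The theorem -/

/-- The Gaussian has the stated Gabor magnitudes on all of `ℝ²`, and any `f ∈ L²(ℝ)` with these
magnitudes on the square lattice `aℤ²` is, as an element of `L²(ℝ)` (that is, almost everywhere),
equal to the Gaussian up to a global phase. -/
theorem corollary2p4 (a : ℝ) (ha0 : 0 < a) (ha1 : a < 1) :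
    (∀ x ω : ℝ,
      ‖gaborTransform normalizedGaussian x ω‖ ^ 2 = Real.exp (-Real.pi * (x ^ 2 + ω ^ 2))) ∧
    ∀ f : ℝ → ℂ, MemLp f 2 volume →
      (∀ m n : ℤ,
        ‖gaborTransform f (a * m) (a * n)‖ ^ 2 =
          Real.exp (-Real.pi * ((a * m) ^ 2 + (a * n) ^ 2))) →
      ∃ α : ℝ, f =ᵐ[volume]
        fun t => Complex.exp (Complex.I * (α : ℂ)) * normalizedGaussian t := by
  refine ⟨fun x ω => ?_, fun f hf hlat => ?_⟩
  · rw [norm_gaborTransform_sq_iff, fockTransform_normalizedGaussian, norm_one]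
  · obtain ⟨C, hC⟩ := exists_norm_gaborTransform_le hf
    have hone (p : ℤ × ℤ) : ‖fockTransform f (a * latticePt p)‖ = 1 := by
      -- Frequency `ω` corresponds to imaginary part `-ω`, hence the sign on the second index.
      have h := (norm_gaborTransform_sq_iff f _ _).1 (hlat p.1 (-p.2))
      rw [← h, latticePt]
      congr 2
      push_cast
      ring
    have hconst (z : ℂ) : fockTransform f (a * z) = fockTransform f (a * 0) := by
      -- Rescaling by `a` turns type `π/2` into `πa²/2`, which is subcritical exactly because `a <
      -- 1`.
      refine eq_of_bounded_on_latticePt (F := fun z => fockTransform f (a * z)) (M := 1) (C := C)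
        (c := Real.pi / 2 * a ^ 2) ((differentiable_fockTransform hf).comp (by fun_prop))
        (by positivity) ?_ (fun z => ?_) (fun p => (hone p).le) z 0
      · have : a ^ 2 < 1 := by nlinarith
        nlinarith [Real.pi_pos]
      · rw [norm_fockTransform, norm_mul, mul_pow, Complex.norm_real, Real.norm_eq_abs, sq_abs,
          ← mul_assoc]
        gcongr
        exact hC _ _
    set k := fockTransform f (a * 0)
    have hk : ‖k‖ = 1 := by simpa [latticePt, k] using hone 0
    have ha : (a : ℂ) ≠ 0 := by exact_mod_cast ha0.ne'
    have hexp : Complex.exp (Complex.I * (Complex.arg k : ℂ)) = k := by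
      have := Complex.norm_mul_exp_arg_mul_I k
      rwa [hk, Complex.ofReal_one, one_mul, mul_comm] at this
    refine ⟨Complex.arg k, ae_eq_of_bargmann_eq hf (memLp_normalizedGaussian.const_mul _)
      fun z => ?_⟩
    have h1 : fockTransform f z = k := by
      rw [← hconst (z / a), mul_div_cancel₀ _ ha]
    have h2 : bargmann (fun t => k * normalizedGaussian t) z = k * bargmann normalizedGaussian z := by
      simp only [bargmann, mul_assoc k, integral_const_mul]
      ring
    rw [hexp, h2]
    refine mul_right_cancel₀ (Complex.exp_ne_zero (-(Real.pi / 2) * z ^ 2)) ?_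
    calc _ = k := h1
      _ = k * fockTransform normalizedGaussian z := by
        rw [fockTransform_normalizedGaussian, mul_one]
      _ = _ := by rw [fockTransform, mul_assoc]
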